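/- Let $R(u)=\frac{1}{1+h/u}\left(I+\frac hu P\right)$ be the normalized Yang $R$-matrix over $\mathbb{C}[[h]]$, where $P$ is the permutation operator on $\mathbb{C}^2\otimes\mathbb{C}^2$. The double Yangian $\mathrm{DY}(\mathfrak{gl}_2)$ is the ($h$-adically completed) associative $\mathbb{C}[[h]]$-algebra generated by a central element $C$ and elements $t_{ij}^{(r)}$ ($i,j=1,2$, $r\in\mathbb{Z}$) with the relations $$R_{12}(u-v)T^{\pm}_{13}(u)T^{\pm}_{23}(v)=T^{\pm}_{23}(v)T^{\pm}_{13}(u)R_{12}(u-v),$$ $$R_{12}(u-v-hC/2)T^{+}_{13}(u)T^{-}_{23}(v)=T^{-}_{23}(v)T^{+}_{13}(u)R_{12}(u-v+hC/2),$$ where $T^\pm(u)=\sum_{i,j} e_{ij}\otimes t^\pm_{ij}(u)$, $t^+_{ij}(u)=\delta_{ij}-h\sum_{r\ge0}t^{(r)}_{ij}u^{-r-1}$ and $t^-_{ij}(u)=\delta_{ij}+h\sum_{r\ge1}t^{(-r)}_{ij}u^{r-1}$. Its Drinfeld generators are the coefficients of $$k_1^\pm(u)=t^\pm_{11}(u),\qquad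 k_2^\pm(u)=t_{22}^\pm(u)-t_{21}^\pm(u)t_{11}^\pm(u)^{-1}t_{12}^\pm(u),$$ $$X^+(u)=t_{11}^+(u-\tfrac{hC}4)^{-1}t_{12}^+(u-\tfrac{hC}4)-t_{11}^-(u+\tfrac{hC}4)^{-1}t_{12}^-(u+\tfrac{hC}4),$$ $$X^-(u)=t_{21}^+(u+\tfrac{hC}4)t_{11}^+(u+\tfrac{hC}4)^{-1}-t_{21}^-(u-\tfrac{hC}4)t_{11}^-(u-\tfrac{hC}4)^{-1},$$ and $X_{\pm\alpha}(u)=h^{-1}X^\pm(u)$. A $\mathrm{DY}(\mathfrak{gl}_2)$-module $V$ is called restricted if it is a topologically free $\mathbb{C}[[h]]$-module (torsion-free, $h$-adically separated and complete) and for all $v\in V$ and $n\ge1$ the series $T^+(u)v$ has only finitely many negative powers of $u$ modulo $h^n$. Let $\varepsilon_1,\varepsilon_2$ be orthonormal with respect to the bilinear form $(\cdot,\cdot)$, $\alpha=\varepsilon_1-\varepsilon_2$, $Q=\mathbb{Z}\alpha$, $\lambda_0=0$, $\lambda_1=\alpha/2$. For $i\in\{0,1\}$ and $s\in\mathbb{C}$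 let $\mathcal{F}_{is}$ be the $h$-adic completion of $$\mathbb{C}[a_j(-r):j=1,2,\ r\ge1][[h]]\otimes\mathbb{C}[Q][[h]]\,e^{\lambda_i+\frac s2(\varepsilon_1+\varepsilon_2)},\qquad \mathcal{F}_i=\mathcal{F}_{i0}.$$ On $\mathcal{F}_{is}$ the elements $a_j(-r)$ act by multiplication and $a_j(r)$ by $r\,\partial/\partial a_j(-r)$ ($r\ge1$), $\partial_\beta(f\otimes e^\mu)=(\beta,\mu)f\otimes e^\mu$ and $e^{\pm\alpha}(f\otimes e^\mu)=f\otimes e^{\mu\pm\alpha}$. All expressions are expanded in nonnegative powers of $h$. Put $$E^-(u)=\exp\sum_{r>0}\left(-\frac{a_1(-r)}r(u-\tfrac34h)^r+\frac{a_2(-r)}r(u+\tfrac h4)^r\right),\qquad E^+(u)=\exp\sum_{r>0}\frac{a_1(r)-a_2(r)}r(u+\tfrac h4)^{-r},$$ $$E^0(u)=e^\alpha(u+\tfrac h4)^{\partial_\alpha},\qquad E^0(u)^{-1}:=e^{-\alpha}(u+\tfrac h4)^{-\partial_\alpha}\ \text{(normally ordered)},$$ $$K_j(u)=\exp\left(-\sum_{r>0}\frac{a_j(r)}r\left((u+\tfrac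 h2)^{-r}-(u-\tfrac h2)^{-r}\right)\right)\quad(j=1,2).$$ The Iohara–Kohno $\mathrm{DY}(\mathfrak{gl}_2)$-module structure on $\mathcal{F}_{is}$ is the one in which $C$ acts as $1$ and $$X_\alpha(u)\mapsto E^-(u)E^+(u)E^0(u),\qquad X_{-\alpha}(u)\mapsto E^-(u+\tfrac h2)^{-1}E^+(u-\tfrac h2)^{-1}E^0(u-\tfrac h2)^{-1},$$ $$k_j^+(u)\mapsto K_j(u)\left(1-\frac h{u+\frac h2}\right)^{\partial_{\varepsilon_j}}\quad(j=1,2),$$ $$k_1^-(u)\mapsto\exp\sum_{r>0}\frac{a_2(-r)}r\left((u+h)^r-u^r\right),\qquad k_2^-(u)\mapsto\exp\sum_{r>0}\frac{a_1(-r)}r\left(u^r-(u-h)^r\right).$$ The normalized $\mathrm{DY}(\mathfrak{gl}_2)$-module structure on $\mathcal{F}_i$ is the one in which $C$ acts as $1$, $k_1^-(u)$ and $k_2^-(u)$ act as above, and $$X_\alpha(u)\mapsto E^-(0)^{-1}E^-(u)E^+(u)E^0(u)\frac{u^{\partial_{\alpha/2}}(u+h)^{\partial_{\alpha/2}}}{(u+\frac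 h4)^{\partial_\alpha}},$$ $$X_{-\alpha}(u)\mapsto E^-(0)E^-(u+\tfrac h2)^{-1}E^+(u-\tfrac h2)^{-1}E^0(u-\tfrac h2)^{-1}\frac{(u-\frac h4)^{\partial_\alpha}}{(u-\frac h2)^{\partial_{\alpha/2}}(u+\frac h2)^{\partial_{\alpha/2}}},$$ $$k_1^+(u)\mapsto K_1(u)\left(\frac{u+\frac h4}{u+\frac{5h}4}\right)^{\partial_{\alpha/2}},\qquad k_2^+(u)\mapsto K_2(u)\left(\frac{u+\frac h4}{u-\frac{3h}4}\right)^{\partial_{\alpha/2}}.$$ Then, for all $i\in\{0,1\}$ and $s\in\mathbb{C}$, the $\mathrm{DY}(\mathfrak{gl}_2)$-modules $\mathcal{F}_{is}$ (with any module structure in which the Drinfeld generators act by the Iohara–Kohno formulas) and $\mathcal{F}_i$ (with any module structure in which they act by the normalized formulas) are restricted. -/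

import Mathlib

open PowerSeries
open scoped Kronecker Nat

noncomputable section

namespace DYgl2

/-! ## The double Yangian of `gl_2`

The ground ring is `ℂ⟦X⟧`; its variable `X` is the formal parameter `h`. -/

/-- The generators `C` and `t_{ij}^{(r)}`, where `i, j ∈ {1, 2}` (numbered `0, 1`) and `r ∈ ℤ`. -/
inductive Gen : Type
  | C : Gen
  | t (i j : Fin 2) (r : ℤ) : Gen

section Series

variable {A : Type*} [Ring A] [Algebra ℂ⟦X⟧ A]

/-- `t_{ij}^+(u) = δ_{ij} - h ∑_{r ≥ 0} t_{ij}^{(r)} u^{-r-1}`, a power series in `u⁻¹`. -/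
def tPlus (t : Fin 2 → Fin 2 → ℤ → A) (i j : Fin 2) : A⟦X⟧ :=
  PowerSeries.mk fun k =>
    if k = 0 then (if i = j then 1 else 0) else -((X : ℂ⟦X⟧) • t i j ((k : ℤ) - 1))

/-- `t_{ij}^-(u) = δ_{ij} + h ∑_{r ≥ 1} t_{ij}^{(-r)} u^{r-1}`, a power series in `u`. -/
def tMinus (t : Fin 2 → Fin 2 → ℤ → A) (i j : Fin 2) : A⟦X⟧ :=
  PowerSeries.mk fun k =>
    (if k = 0 ∧ i = j then 1 else 0) + (X : ℂ⟦X⟧) • t i j (-((k : ℤ) + 1))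

/-- The two-sided series in `u` given by a power series in `u`: `k ↦` coefficient of `u^k`. -/
def inU (f : A⟦X⟧) (k : ℤ) : A := if 0 ≤ k then coeff k.toNat f else 0

/-- The two-sided series in `u` given by a power series in `u⁻¹`:
`k ↦` coefficient of `u^k`. -/
def inUInv (f : A⟦X⟧) (k : ℤ) : A := if k ≤ 0 then coeff (-k).toNat f else 0

/-- `End ℂ² ⊗ End ℂ² ⊗ A`. -/
abbrev Mat (A : Type*) := Matrix (Fin 2 × Fin 2) (Fin 2 × Fin 2) A

/-- The coefficient of `u^a` in `T_{13}(u) = ∑ e_{ij} ⊗ 1 ⊗ τ_{ij}(u)`. -/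
def T13 (τ : Fin 2 → Fin 2 → ℤ → A) (a : ℤ) : Mat A :=
  (Matrix.of fun i j => τ i j a) ⊗ₖ (1 : Matrix (Fin 2) (Fin 2) A)

/-- The coefficient of `v^b` in `T_{23}(v) = ∑ 1 ⊗ e_{ij} ⊗ τ_{ij}(v)`. -/
def T23 (τ : Fin 2 → Fin 2 → ℤ → A) (b : ℤ) : Mat A :=
  (1 : Matrix (Fin 2) (Fin 2) A) ⊗ₖ (Matrix.of fun i j => τ i j b)

/-- The permutation operator `P` on `ℂ² ⊗ ℂ²`. -/
def P : Mat A := Matrix.of fun p q => if p.1 = q.2 ∧ p.2 = q.1 then 1 else 0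

/-- Multiplication by `u - v` of a two-sided series `F = ∑ F_{ab} u^a v^b`. -/
def mulUV (F : ℤ → ℤ → Mat A) (a b : ℤ) : Mat A := F (a - 1) b - F a (b - 1)

/-- Multiplication by `u - v + x h C` of a two-sided series, where `x ∈ ℂ`. -/
def mulUVC (x : ℂ) (C : A) (F : ℤ → ℤ → Mat A) (a b : ℤ) : Mat A :=
  mulUV F a b + (PowerSeries.C x * X : ℂ⟦X⟧) • (C • F a b)

/-- The left side of `(u - v + hP) T_{13}(u) T_{23}(v) = T_{23}(v) T_{13}(u) (u - v + hP)`,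
coefficient of `u^a v^b`.

As `R(x) = (x + hP) / (x + h)`, this is the relation
`R_{12}(u - v) T_{13}(u) T_{23}(v) = T_{23}(v) T_{13}(u) R_{12}(u - v)` multiplied by the scalar
`u - v + h`. -/
def rttSameL (τ : Fin 2 → Fin 2 → ℤ → A) (a b : ℤ) : Mat A :=
  mulUV (fun a b => T13 τ a * T23 τ b) a b + (X : ℂ⟦X⟧) • (P * (T13 τ a * T23 τ b))

/-- The right side of `(u - v + hP) T_{13}(u) T_{23}(v) = T_{23}(v) T_{13}(u) (u - v + hP)`,
coefficient of `u^a v^b`. -/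
def rttSameR (τ : Fin 2 → Fin 2 → ℤ → A) (a b : ℤ) : Mat A :=
  mulUV (fun a b => T23 τ b * T13 τ a) a b + (X : ℂ⟦X⟧) • ((T23 τ b * T13 τ a) * P)

/-- Write `x_∓ = u - v ∓ hC/2`.  The relation
`R_{12}(x_-) T_{13}^+(u) T_{23}^-(v) = T_{23}^-(v) T_{13}^+(u) R_{12}(x_+)`, with
`R(x) = (x + hP) / (x + h)` expanded in nonnegative powers of `v/u` and `h/u`, is equivalent to
`(x_+ + h)(x_- + hP) T_{13}^+(u) T_{23}^-(v) = (x_- + h) T_{23}^-(v) T_{13}^+(u) (x_+ + hP)`,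
since `x_± + h` are invertible in this expansion.
This is the coefficient of `u^a v^b` in its left side. -/
def rttMixedL (C : A) (τp τm : Fin 2 → Fin 2 → ℤ → A) (a b : ℤ) : Mat A :=
  let G : ℤ → ℤ → Mat A := fun a b => T13 τp a * T23 τm b
  let L : ℤ → ℤ → Mat A := fun a b => mulUVC (-1 / 2) C G a b + (X : ℂ⟦X⟧) • (P * G a b)
  mulUVC (1 / 2) C L a b + (X : ℂ⟦X⟧) • L a b

/-- The right side of the mixed relation, see `rttMixedL`. -/
def rttMixedR (C : A) (τp τm : Fin 2 → Fin 2 → ℤ → A) (a b : ℤ) : Mat A :=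
  let G : ℤ → ℤ → Mat A := fun a b => T23 τm b * T13 τp a
  let L : ℤ → ℤ → Mat A := fun a b => mulUVC (1 / 2) C G a b + (X : ℂ⟦X⟧) • (G a b * P)
  mulUVC (-1 / 2) C L a b + (X : ℂ⟦X⟧) • L a b

end Series

/-- The free algebra on the generators of the double Yangian. -/
abbrev FreeDY : Type := FreeAlgebra ℂ⟦X⟧ Gen

/-- The generator `C` in the free algebra. -/
def freeC : FreeDY := FreeAlgebra.ι ℂ⟦X⟧ Gen.C

/-- The generators `t_{ij}^{(r)}` in the free algebra. -/
def freeT (i j : Fin 2) (r : ℤ) : FreeDY := FreeAlgebra.ι ℂ⟦X⟧ (Gen.t i j r)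

/-- The series `t_{ij}^+(u)` over the free algebra. -/
def freeTPlus (i j : Fin 2) : ℤ → FreeDY := inUInv (tPlus freeT i j)

/-- The series `t_{ij}^-(u)` over the free algebra. -/
def freeTMinus (i j : Fin 2) : ℤ → FreeDY := inU (tMinus freeT i j)

/-- The defining relations of the double Yangian: `C` is central, and the matrix entries of the
coefficients of the three `RTT`-relations. -/
inductive Rel : FreeDY → FreeDY → Prop
  | central (i j : Fin 2) (r : ℤ) : Rel (freeC * freeT i j r) (freeT i j r * freeC)
  | plus (a b : ℤ) (p q : Fin 2 × Fin 2) :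
      Rel (rttSameL freeTPlus a b p q) (rttSameR freeTPlus a b p q)
  | minus (a b : ℤ) (p q : Fin 2 × Fin 2) :
      Rel (rttSameL freeTMinus a b p q) (rttSameR freeTMinus a b p q)
  | mixed (a b : ℤ) (p q : Fin 2 × Fin 2) :
      Rel (rttMixedL freeC freeTPlus freeTMinus a b p q)
        (rttMixedR freeC freeTPlus freeTMinus a b p q)

/-- The double Yangian `DY(gl_2)` over `ℂ⟦h⟧`. -/
abbrev DY : Type := RingQuot Rel

/-- The central element `C` of the double Yangian. -/
def DY.C : DY := RingQuot.mkAlgHom ℂ⟦X⟧ Rel freeC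

/-- The generators `t_{ij}^{(r)}` of the double Yangian. -/
def DY.t (i j : Fin 2) (r : ℤ) : DY := RingQuot.mkAlgHom ℂ⟦X⟧ Rel (freeT i j r)

/-! ## Modules for the double Yangian

A structure of `DY(gl_2)`-module on a `ℂ⟦h⟧`-module `V` is an algebra homomorphism
`ρ : DY →ₐ[ℂ⟦X⟧] Module.End ℂ⟦X⟧ V`.  All modules below are topologically free; then
`Module.End ℂ⟦X⟧ V` is `h`-adically complete and separated, so that such homomorphisms extend
uniquely to the `h`-adic completion of `DY(gl_2)` and this is the same as a module for the
completion. -/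

section Modules

variable {V : Type*} [AddCommGroup V] [Module ℂ⟦X⟧ V]

/-- Topologically free `ℂ⟦h⟧`-modules: torsion-free, `h`-adically separated and complete. -/
def IsTopologicallyFree (V : Type*) [AddCommGroup V] [Module ℂ⟦X⟧ V] : Prop :=
  Module.IsTorsionFree ℂ⟦X⟧ V ∧ IsAdicComplete (Ideal.span {(X : ℂ⟦X⟧)}) V

/-- The operators by which the generators `t_{ij}^{(r)}` act. -/
def opT (ρ : DY →ₐ[ℂ⟦X⟧] Module.End ℂ⟦X⟧ V) (i j : Fin 2) (r : ℤ) : Module.End ℂ⟦X⟧ V :=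
  ρ (DY.t i j r)

/-- Restricted modules: `V` is topologically free and for all `v ∈ V`, `n ≥ 1` all but finitely
many coefficients of `T^+(u) v`, a series in nonpositive powers of `u`, lie in `h^n V`. -/
def IsRestricted (ρ : DY →ₐ[ℂ⟦X⟧] Module.End ℂ⟦X⟧ V) : Prop :=
  IsTopologicallyFree V ∧
    ∀ (v : V) (n : ℕ), 1 ≤ n → ∀ i j : Fin 2, ∃ N : ℕ, ∀ k ≥ N,
      ∃ w : V, coeff k (tPlus (opT ρ) i j) v = (X ^ n : ℂ⟦X⟧) • w

/-- `x` is the `h`-adically convergent sum of the `f l`. -/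
def HasHSum (f : ℕ → V) (x : V) : Prop :=
  ∀ n : ℕ, ∃ N : ℕ, ∀ M ≥ N, ∃ w : V, x - ∑ l ∈ Finset.range M, f l = (X ^ n : ℂ⟦X⟧) • w

/-- For a two-sided series `a(u) = ∑ a_k u^k` of operators, the coefficient of `u^k` in
`a(u + c h C)` is `∑_l binom(k + l, l) (c h C)^l a_{k+l}` (powers of `u + c h C` are expanded in
nonnegative powers of `h`).  This is the `l`-th term of that sum. -/
def shiftTerm (c : ℂ) (opC : Module.End ℂ⟦X⟧ V) (a : ℤ → Module.End ℂ⟦X⟧ V) (k : ℤ) (l : ℕ) :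
    Module.End ℂ⟦X⟧ V :=
  (PowerSeries.C ((Ring.choose (k + (l : ℤ)) l : ℤ) * c ^ l : ℂ) * X ^ l : ℂ⟦X⟧) •
    (opC ^ l * a (k + (l : ℤ)))

/-- A `DY(gl_2)`-module whose Drinfeld generators
`k_1^±(u) = t_{11}^±(u)`, `k_2^±(u) = t_{22}^±(u) - t_{21}^±(u) t_{11}^±(u)⁻¹ t_{12}^±(u)`,
`X^+(u) = t_{11}^+(u - hC/4)⁻¹ t_{12}^+(u - hC/4) - t_{11}^-(u + hC/4)⁻¹ t_{12}^-(u + hC/4)`,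
`X^-(u) = t_{21}^+(u + hC/4) t_{11}^+(u + hC/4)⁻¹ - t_{21}^-(u - hC/4) t_{11}^-(u - hC/4)⁻¹`
act by the given series `X^±(u) = h X_{±α}(u)` and `k_j^±(u)` (`k ↦` coefficient of `u^k`).

The constant term of `t_{11}^±` is the identity modulo `h`, so that `t_{11}^±` is invertible when
`V` is topologically free and `Ring.inverse` is its inverse. -/
structure DrinfeldActsBy (ρ : DY →ₐ[ℂ⟦X⟧] Module.End ℂ⟦X⟧ V)
    (xp xm : ℤ → V → V) (kp km : Fin 2 → ℤ → V → V) : Prop where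
  k1_plus : ∀ k v, inUInv (tPlus (opT ρ) 0 0) k v = kp 0 k v
  k1_minus : ∀ k v, inU (tMinus (opT ρ) 0 0) k v = km 0 k v
  k2_plus : ∀ k v, inUInv (tPlus (opT ρ) 1 1 -
      tPlus (opT ρ) 1 0 * Ring.inverse (tPlus (opT ρ) 0 0) * tPlus (opT ρ) 0 1) k v = kp 1 k v
  k2_minus : ∀ k v, inU (tMinus (opT ρ) 1 1 -
      tMinus (opT ρ) 1 0 * Ring.inverse (tMinus (opT ρ) 0 0) * tMinus (opT ρ) 0 1) k v = km 1 k v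
  x_plus : ∀ k v, HasHSum (fun l =>
      (shiftTerm (-1 / 4) (ρ DY.C)
        (inUInv (Ring.inverse (tPlus (opT ρ) 0 0) * tPlus (opT ρ) 0 1)) k l -
      shiftTerm (1 / 4) (ρ DY.C)
        (inU (Ring.inverse (tMinus (opT ρ) 0 0) * tMinus (opT ρ) 0 1)) k l) v)
      ((X : ℂ⟦X⟧) • xp k v)
  x_minus : ∀ k v, HasHSum (fun l =>
      (shiftTerm (1 / 4) (ρ DY.C)
        (inUInv (tPlus (opT ρ) 1 0 * Ring.inverse (tPlus (opT ρ) 0 0))) k l -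
      shiftTerm (-1 / 4) (ρ DY.C)
        (inU (tMinus (opT ρ) 1 0 * Ring.inverse (tMinus (opT ρ) 0 0))) k l) v)
      ((X : ℂ⟦X⟧) • xm k v)

end Modules

/-! ## The Fock space and the vertex operators -/

/-- `U(ŝ⁻) = ℂ[a_j(-r) : j = 1, 2, r ≥ 1]`; the variable `(j, r)` is `a_j(-r)`. -/
abbrev SymAlg : Type := MvPolynomial (Fin 2 × ℕ+) ℂ

/-- `U(ŝ⁻) ⊗ ℂ[Q] e^{λ_i + (s/2)(ε_1 + ε_2)}`, a free `U(ŝ⁻)`-module with the basis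
`e^{mα + λ_i + (s/2)(ε_1 + ε_2)}`, `m ∈ ℤ`, which is `single m 1`.  The underlying space does not
depend on `i` and `s`, the operators do. -/
abbrev Fock₀ : Type := AddMonoidAlgebra SymAlg ℤ

/-- The topologically free `ℂ⟦h⟧`-module `F_{is} = (U(ŝ⁻) ⊗ ℂ[Q] e^{λ_i + …})⟦h⟧`. -/
abbrev Fock : Type := Fock₀⟦X⟧

/-- `(ε_j, μ)` for `μ = mα + λ_i + (s/2)(ε_1 + ε_2)`, where `λ_0 = 0` and `λ_1 = α/2`,
`α = ε_1 - ε_2`. -/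
def wt (i : Fin 2) (s : ℂ) (j : Fin 2) (m : ℤ) : ℂ :=
  (if j = 0 then 1 else -1) * ((m : ℂ) + (i : ℕ) / 2) + s / 2

/-- `(α, μ)` for `μ = mα + λ_i + (s/2)(ε_1 + ε_2)`, an integer. -/
def wtα (i : Fin 2) (m : ℤ) : ℤ := 2 * m + (i : ℕ)

/-- The action of `a_j(-r)`, `r ≥ 1`: `f ⊗ e^μ ↦ a_j(-r) f ⊗ e^μ`. -/
def create (j : Fin 2) (r : ℕ+) : Module.End ℂ Fock₀ :=
  LinearMap.mulLeft ℂ (AddMonoidAlgebra.single 0 (MvPolynomial.X (j, r)))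

/-- The action of `a_j(r)`, `r ≥ 1`: `f ⊗ e^μ ↦ [a_j(r), f] ⊗ e^μ`, where `C` acts as `1`,
i.e. `[a_j(r), ·] = r ∂/∂a_j(-r)`. -/
def annihilate (j : Fin 2) (r : ℕ+) : Module.End ℂ Fock₀ where
  toFun v := AddMonoidAlgebra.ofCoeff
    (v.coeff.mapRange (fun f => (r : ℂ) • MvPolynomial.pderiv (j, r) f) (by simp))
  map_add' v w := by ext; simp
  map_smul' c v := by ext; simp [mul_left_comm]

/-- Power series `∑ A_{kl} w^k h^l` of operators on `Fock₀`, where `w = u` or `w = u⁻¹`;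
`A_{kl} = coeff l (coeff k A)`. -/
abbrev OpSeries : Type := (Module.End ℂ Fock₀)⟦X⟧⟦X⟧

/-- `∑_{r > 0} (a_j(-r) / r) (u + c h)^r`, a power series in `u` and `h`: the coefficient of
`u^k h^l` comes from `r = k + l`. -/
def createSum (j : Fin 2) (c : ℂ) : OpSeries :=
  PowerSeries.mk fun k => PowerSeries.mk fun l =>
    if hr : 0 < k + l then
      (((k + l).choose l : ℂ) * c ^ l / ((k + l : ℕ) : ℂ)) • create j ⟨k + l, hr⟩
    else 0

/-- `∑_{r > 0} (a_j(r) / r) (u + c h)^{-r}`, a power series in `u⁻¹` and `h`: the coefficient of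
`u^{-k} h^l` comes from `r = k - l`, with the binomial coefficient `binom(-r, l)`. -/
def annihilateSum (j : Fin 2) (c : ℂ) : OpSeries :=
  PowerSeries.mk fun k => PowerSeries.mk fun l =>
    if hr : 0 < k - l then
      ((Ring.choose (-((k - l : ℕ) : ℤ)) l : ℤ) * c ^ l / ((k - l : ℕ) : ℂ)) •
        annihilate j ⟨k - l, hr⟩
    else 0

/-- The exponential `∑_n G^n / n!` of a power series `G` in two variables without constant term
(so that only `n ≤ k + l` contribute to the coefficient of `w^k h^l`). -/
def fexp (G : OpSeries) : OpSeries :=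
  PowerSeries.mk fun k => PowerSeries.mk fun l =>
    ∑ n ∈ Finset.range (k + l + 1), ((n ! : ℂ)⁻¹) • coeff l (coeff k (G ^ n))

/-- The exponent of `E^-(u + c h)`. -/
def exponentMinus (c : ℂ) : OpSeries := -createSum 0 (c - 3 / 4) + createSum 1 (c + 1 / 4)

/-- The exponent of `E^+(u + c h)`. -/
def exponentPlus (c : ℂ) : OpSeries := annihilateSum 0 (c + 1 / 4) - annihilateSum 1 (c + 1 / 4)

/-- Two-sided series `A(u) = ∑_{k ∈ ℤ, l ≥ 0} A_{kl} u^k h^l` of operators on `Fock₀`: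
`A v k l = A_{kl} v`. -/
abbrev Vertex : Type := Fock₀ → ℤ → ℕ → Fock₀

/-- A power series in `u` and `h` as a two-sided series. -/
def vertexU (E : OpSeries) : Vertex := fun v k l =>
  if 0 ≤ k then coeff l (coeff k.toNat E) v else 0

/-- A power series in `u⁻¹` and `h` as a two-sided series. -/
def vertexUInv (E : OpSeries) : Vertex := fun v k l =>
  if k ≤ 0 then coeff l (coeff (-k).toNat E) v else 0

/-- The value at `u = 0` of a power series in `u` and `h`, as a two-sided series. -/
def vertexAtZero (E : OpSeries) : Vertex := fun v k l =>
  if k = 0 then coeff l (coeff 0 E) v else 0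

/-- `f(x)^z = ∑_n binom(z, n) (f(x) - 1)^n` for a power series `f` with constant term `1` and
`z ∈ ℂ`. -/
def cpow (f : ℂ⟦X⟧) (z : ℂ) : ℂ⟦X⟧ :=
  PowerSeries.mk fun n => ∑ j ∈ Finset.range (n + 1), Ring.choose z j * coeff n ((f - 1) ^ j)

/-- The power series `1 + c x` in `x = h / u`; thus `u + c h = u · lin c`. -/
def lin (c : ℂ) : ℂ⟦X⟧ := 1 + PowerSeries.C c * X

/-- The series `f ⊗ e^μ ↦ u^{p(m)} g_m(h / u) f ⊗ e^{dα + μ}`, where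
`μ = mα + λ_i + (s/2)(ε_1 + ε_2)`. -/
def zeroMode (d : ℤ) (p : ℤ → ℤ) (g : ℤ → ℂ⟦X⟧) : Vertex := fun v k l =>
  v.coeff.sum fun m f =>
    if k = p m - l then AddMonoidAlgebra.single (m + d) (coeff l (g m) • f) else 0

/-- The composition `A(u) B(u)`.  In all compositions below the sum over `k'` is finite. -/
def comp (A B : Vertex) : Vertex := fun v k l =>
  ∑ᶠ k' : ℤ, ∑ p ∈ Finset.HasAntidiagonal.antidiagonal l, A (B v k' p.2) (k - k') p.1

/-- The `ℂ⟦h⟧`-linear extension to `Fock`: the coefficient of `u^k` in `A(u) v`. -/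
def extend (A : Vertex) (k : ℤ) (v : Fock) : Fock :=
  PowerSeries.mk fun N => ∑ p ∈ Finset.HasAntidiagonal.antidiagonal N, A (coeff p.2 v) k p.1

/-- `E^-(u + c h)`. -/
def EMinus (c : ℂ) : Vertex := vertexU (fexp (exponentMinus c))

/-- `E^-(u + c h)⁻¹`. -/
def EMinusInv (c : ℂ) : Vertex := vertexU (fexp (-exponentMinus c))

/-- `E^+(u + c h)`. -/
def EPlus (c : ℂ) : Vertex := vertexUInv (fexp (exponentPlus c))

/-- `E^+(u + c h)⁻¹`. -/
def EPlusInv (c : ℂ) : Vertex := vertexUInv (fexp (-exponentPlus c))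

/-- `E^-(0)`. -/
def EMinusZero : Vertex := vertexAtZero (fexp (exponentMinus 0))

/-- `E^-(0)⁻¹`. -/
def EMinusZeroInv : Vertex := vertexAtZero (fexp (-exponentMinus 0))

/-- `E^0(u + c h) = e^α (u + (c + 1/4) h)^{∂_α}`. -/
def EZero (i : Fin 2) (c : ℂ) : Vertex :=
  zeroMode 1 (wtα i) fun m => cpow (lin (c + 1 / 4)) (wtα i m)

/-- `E^0(u + c h)^{-1}`, in the normal-ordered sense `e^{-α} (u + (c + 1/4) h)^{-∂_α}`. -/
def EZeroInv (i : Fin 2) (c : ℂ) : Vertex :=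
  zeroMode (-1) (fun m => -wtα i m) fun m => cpow (lin (c + 1 / 4)) (-(wtα i m : ℂ))

/-- `exp(-∑_{r > 0} (a_j(r) / r) ((u + h/2)^{-r} - (u - h/2)^{-r}))`. -/
def kPlusExp (j : Fin 2) : Vertex :=
  vertexUInv (fexp (-(annihilateSum j (1 / 2) - annihilateSum j (-1 / 2))))

/-- `k_1^-(u) = exp(∑_{r > 0} (a_2(-r) / r) ((u + h)^r - u^r))` and
`k_2^-(u) = exp(∑_{r > 0} (a_1(-r) / r) (u^r - (u - h)^r))`. -/
def kMinus (j : Fin 2) : Vertex :=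
  vertexU (fexp (if j = 0 then createSum 1 1 - createSum 1 0 else createSum 0 0 - createSum 0 (-1)))

/-! ### The Iohara–Kohno realization -/

/-- `X_α(u) = E^-(u) E^+(u) E^0(u)`. -/
def xPlusIK (i : Fin 2) : Vertex := comp (EMinus 0) (comp (EPlus 0) (EZero i 0))

/-- `X_{-α}(u) = E^-(u + h/2)⁻¹ E^+(u - h/2)⁻¹ E^0(u - h/2)⁻¹`. -/
def xMinusIK (i : Fin 2) : Vertex :=
  comp (EMinusInv (1 / 2)) (comp (EPlusInv (-1 / 2)) (EZeroInv i (-1 / 2)))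

/-- `k_j^+(u)` is `kPlusExp j` times `(1 - h / (u + h/2))^{∂_{ε_j}}`. -/
def kPlusIK (i : Fin 2) (s : ℂ) (j : Fin 2) : Vertex :=
  comp (kPlusExp j)
    (zeroMode 0 (fun _ => 0) fun m => cpow (1 - X * (lin (1 / 2))⁻¹) (wt i s j m))

/-- The structure of level `1` module for `DY(gl_2)` on `F_{is}` given by Iohara and Kohno. -/
def IsIoharaKohno (i : Fin 2) (s : ℂ) (ρ : DY →ₐ[ℂ⟦X⟧] Module.End ℂ⟦X⟧ Fock) : Prop :=
  ρ DY.C = 1 ∧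
    DrinfeldActsBy ρ (extend (xPlusIK i)) (extend (xMinusIK i))
      (fun j => extend (kPlusIK i s j)) (fun j => extend (kMinus j))

/-! ### The normalized Iohara–Kohno realization, on `F_i = F_{i0}` -/

/-- `X_α(u) = E^-(0)⁻¹ E^-(u) E^+(u) E^0(u)
  (u^{∂_{α/2}} (u + h)^{∂_{α/2}} / (u + h/4)^{∂_α})`. -/
def xPlusNorm (i : Fin 2) : Vertex :=
  comp EMinusZeroInv (comp (EMinus 0) (comp (EPlus 0) (comp (EZero i 0)
    (zeroMode 0 (fun _ => 0) fun m =>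
      cpow (lin 1) (wtα i m / 2) * cpow (lin (1 / 4)) (-(wtα i m : ℂ))))))

/-- `X_{-α}(u) = E^-(0) E^-(u + h/2)⁻¹ E^+(u - h/2)⁻¹ E^0(u - h/2)⁻¹
  ((u - h/4)^{∂_α} / ((u - h/2)^{∂_{α/2}} (u + h/2)^{∂_{α/2}}))`. -/
def xMinusNorm (i : Fin 2) : Vertex :=
  comp EMinusZero (comp (EMinusInv (1 / 2)) (comp (EPlusInv (-1 / 2)) (comp (EZeroInv i (-1 / 2))
    (zeroMode 0 (fun _ => 0) fun m =>
      cpow (lin (-1 / 4)) (wtα i m) * cpow (lin (-1 / 2)) (-(wtα i m : ℂ) / 2) *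
        cpow (lin (1 / 2)) (-(wtα i m : ℂ) / 2)))))

/-- `k_1^+(u)` is `kPlusExp 0` times `((u + h/4) / (u + 5h/4))^{∂_{α/2}}` and
`k_2^+(u)` is `kPlusExp 1` times `((u + h/4) / (u - 3h/4))^{∂_{α/2}}`. -/
def kPlusNorm (i : Fin 2) (j : Fin 2) : Vertex :=
  comp (kPlusExp j) (zeroMode 0 (fun _ => 0) fun m =>
    cpow (lin (1 / 4) * (lin (if j = 0 then 5 / 4 else -3 / 4))⁻¹) (wtα i m / 2))

/-- The normalized structure of level `1` module for `DY(gl_2)` on `F_i`. -/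
def IsNormalizedIoharaKohno (i : Fin 2) (ρ : DY →ₐ[ℂ⟦X⟧] Module.End ℂ⟦X⟧ Fock) : Prop :=
  ρ DY.C = 1 ∧
    DrinfeldActsBy ρ (extend (xPlusNorm i)) (extend (xMinusNorm i))
      (fun j => extend (kPlusNorm i j)) (fun j => extend (kMinus j))

end DYgl2

end

/-!
Let `h` be the formal parameter.  Modulo `h^n`, a vector of the Fock space has finitely many
coefficients, and each of them is a polynomial in the `a_j(-r)` times finitely many `e^μ`.  In the
annihilation parts of the vertex operators the coefficient of `u^{-k} h^l` lowers the degree by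
`k - l` (`LowersDegree`), so that it kills a given vector when `k` is large.  Creation parts
contain only nonnegative powers of `u`, and zero modes finitely many powers of `u` for each power of
`h` and each vector.  Hence the Drinfeld series, applied to a vector, have only finitely many
negative powers of `u` modulo `h^n` (`BddBelowPowers.extend_mem_hPow`).

The negative part of `h X_α(u)` is `(t_{11}^+)⁻¹ t_{12}^+` at a shifted argument, because the
summand with `t^-` has only nonnegative powers of `u`.  The shift changes a series by
terms with higher powers of `h`, so by induction on `n` the unshifted series also truncates modulo
`h^n` (`truncates_of_hasHSum`); likewise for `t_{21}^+ (t_{11}^+)⁻¹` and `X_{-α}(u)`.  Truncating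
series are closed under sums and products (`Truncates.add`, `Truncates.mul`), and by the Gauss
decomposition all `t_{ij}^+` are sums of products of these two series and `k_1^+`, `k_2^+`
(`isRestricted_of_drinfeldActsBy`).  In particular the inverse of `t_{11}^+` need not truncate.
-/

noncomputable section

namespace DYgl2

/-! ### Truncation modulo powers of `h` -/

section Truncation

variable {V : Type*} [AddCommGroup V] [Module ℂ⟦X⟧ V]

/-- The submodule `h^n V`. -/
def hPow (V : Type*) [AddCommGroup V] [Module ℂ⟦X⟧ V] (n : ℕ) : Submodule ℂ⟦X⟧ V :=
  LinearMap.range (LinearMap.lsmul ℂ⟦X⟧ V (X ^ n))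

lemma mem_hPow {n : ℕ} {x : V} : x ∈ hPow V n ↔ ∃ w : V, x = (X ^ n : ℂ⟦X⟧) • w := by
  simp [hPow, eq_comm]

lemma mem_hPow_zero (x : V) : x ∈ hPow V 0 := mem_hPow.2 ⟨x, by simp⟩

lemma hPow_antitone {m n : ℕ} (h : m ≤ n) : hPow V n ≤ hPow V m := by
  intro x hx
  obtain ⟨w, rfl⟩ := mem_hPow.1 hx
  exact mem_hPow.2 ⟨(X ^ (n - m) : ℂ⟦X⟧) • w, by rw [smul_smul, ← pow_add, Nat.add_sub_cancel' h]⟩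

lemma X_pow_smul_mem_hPow {n : ℕ} (l : ℕ) {x : V} (hx : x ∈ hPow V n) :
    (X ^ l : ℂ⟦X⟧) • x ∈ hPow V (l + n) := by
  obtain ⟨w, rfl⟩ := mem_hPow.1 hx
  exact mem_hPow.2 ⟨w, by rw [smul_smul, ← pow_add]⟩

lemma map_mem_hPow {n : ℕ} (f : Module.End ℂ⟦X⟧ V) {x : V} (hx : x ∈ hPow V n) :
    f x ∈ hPow V n := by
  obtain ⟨w, rfl⟩ := mem_hPow.1 hx
  exact mem_hPow.2 ⟨f w, by simp⟩

/-- A power series `f(u⁻¹)` of operators such that, for every vector `v` and every `n`, all but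
finitely many coefficients of `f(u⁻¹) v` lie in `h^n V`. -/
def Truncates (f : (Module.End ℂ⟦X⟧ V)⟦X⟧) : Prop :=
  ∀ (v : V) (n : ℕ), ∃ N : ℕ, ∀ k ≥ N, coeff k f v ∈ hPow V n

lemma Truncates.add {f g : (Module.End ℂ⟦X⟧ V)⟦X⟧} (hf : Truncates f) (hg : Truncates g) :
    Truncates (f + g) := by
  intro v n
  obtain ⟨N, hN⟩ := hf v n
  obtain ⟨M, hM⟩ := hg v n
  refine ⟨max N M, fun k hk => ?_⟩
  rw [map_add, LinearMap.add_apply]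
  exact add_mem (hN k (le_of_max_le_left hk)) (hM k (le_of_max_le_right hk))

/-- Modulo `h^n` only finitely many coefficients of `g(u⁻¹) v` matter, and `f(u⁻¹)` truncates on
each of them. -/
lemma Truncates.mul {f g : (Module.End ℂ⟦X⟧ V)⟦X⟧} (hf : Truncates f) (hg : Truncates g) :
    Truncates (f * g) := by
  intro v n
  obtain ⟨N, hN⟩ := hg v n
  choose M hM using fun j : ℕ => hf (coeff j g v) n
  refine ⟨N + (Finset.range N).sup M, fun k hk => ?_⟩
  rw [coeff_mul, LinearMap.sum_apply]
  refine sum_mem fun p hp => ?_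
  rw [Finset.HasAntidiagonal.mem_antidiagonal] at hp
  rw [Module.End.mul_apply]
  rcases lt_or_ge p.2 N with h | h
  · have := Finset.le_sup (f := M) (Finset.mem_range.2 h)
    exact hM p.2 p.1 (by omega)
  · exact map_mem_hPow _ (hN p.2 h)

/-- Shifting the variable of a power series in `u` yields no negative powers of `u`. -/
lemma shiftTerm_inU_of_neg (c : ℂ) (opC : Module.End ℂ⟦X⟧ V) (b : (Module.End ℂ⟦X⟧ V)⟦X⟧)
    {k : ℤ} (hk : k < 0) (l : ℕ) : shiftTerm c opC (inU b) k l = 0 := by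
  rcases lt_or_ge (k + l) 0 with h | h
  · simp [shiftTerm, inU, not_le.2 h]
  · obtain ⟨m, hm⟩ := Int.eq_ofNat_of_zero_le h
    have : Ring.choose (k + (l : ℤ)) l = 0 := by
      rw [hm, Ring.choose_natCast, Nat.choose_eq_zero_of_lt (by omega)]
      rfl
    simp [shiftTerm, this]

/-- If the negative part of the difference of a shifted series in `u⁻¹` and a shifted series in `u`
truncates, then so does the unshifted series in `u⁻¹`.  The terms other than the unshifted one
carry a positive power of `h`, which allows induction on the exponent of `h`. -/
lemma truncates_of_hasHSum {c c' : ℂ} {opC : Module.End ℂ⟦X⟧ V} {a b : (Module.End ℂ⟦X⟧ V)⟦X⟧}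
    {x : ℤ → V → V} (hx : ∀ v n, ∃ N : ℕ, ∀ k ≥ N, x (-(k : ℤ)) v ∈ hPow V n)
    (h : ∀ k v, HasHSum (fun l =>
      (shiftTerm c opC (inUInv a) k l - shiftTerm c' opC (inU b) k l) v) ((X : ℂ⟦X⟧) • x k v)) :
    Truncates a := by
  intro v n
  induction n with
  | zero => exact ⟨0, fun k _ => mem_hPow_zero _⟩
  | succ n ih =>
    obtain ⟨N₁, h₁⟩ := ih
    obtain ⟨N₂, h₂⟩ := hx v (n + 1)
    refine ⟨N₁ + N₂ + n + 2, fun k hk => ?_⟩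
    obtain ⟨N₃, h₃⟩ := h (-(k : ℤ)) v (n + 1)
    have hsum := mem_hPow.2 (h₃ (N₃ + 1) (by omega))
    have hX : (X : ℂ⟦X⟧) • x (-(k : ℤ)) v ∈ hPow V (n + 1) :=
      Submodule.smul_mem _ _ (h₂ k (by omega))
    simp only [shiftTerm_inU_of_neg c' opC b (show -(k : ℤ) < 0 by omega), sub_zero] at hsum
    have hsum := sub_mem hX hsum
    rw [sub_sub_cancel, Finset.sum_range_succ'] at hsum
    have htail : ∑ l ∈ Finset.range N₃, shiftTerm c opC (inUInv a) (-(k : ℤ)) (l + 1) v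
        ∈ hPow V (n + 1) := by
      refine sum_mem fun l _ => ?_
      rw [shiftTerm, LinearMap.smul_apply, mul_smul]
      refine Submodule.smul_mem _ _ ?_
      rw [Module.End.mul_apply]
      rcases le_or_gt n l with hl | hl
      · exact hPow_antitone (by omega) (X_pow_smul_mem_hPow (l + 1) (mem_hPow_zero _))
      · refine hPow_antitone (show n + 1 ≤ l + 1 + n by omega)
          (X_pow_smul_mem_hPow (l + 1) (map_mem_hPow _ ?_))
        rw [inUInv, if_pos (by push_cast; omega)]
        exact h₁ _ (by omega)
    have hhead := (add_mem_cancel_left htail).1 hsum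
    simpa [shiftTerm, inUInv] using hhead

/-- The Gauss decomposition
`t_{12} = t_{11} (t_{11}⁻¹ t_{12})`, `t_{21} = (t_{21} t_{11}⁻¹) t_{11}`,
`t_{22} = k_2 + (t_{21} t_{11}⁻¹) t_{12}` reduces restrictedness to the truncation of the series
through which the Drinfeld generators act. -/
lemma isRestricted_of_drinfeldActsBy (hV : IsTopologicallyFree V)
    {ρ : DY →ₐ[ℂ⟦X⟧] Module.End ℂ⟦X⟧ V} {xp xm : ℤ → V → V} {kp km : Fin 2 → ℤ → V → V}
    (h : DrinfeldActsBy ρ xp xm kp km)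
    (hxp : ∀ v n, ∃ N : ℕ, ∀ k ≥ N, xp (-(k : ℤ)) v ∈ hPow V n)
    (hxm : ∀ v n, ∃ N : ℕ, ∀ k ≥ N, xm (-(k : ℤ)) v ∈ hPow V n)
    (hkp : ∀ j v n, ∃ N : ℕ, ∀ k ≥ N, kp j (-(k : ℤ)) v ∈ hPow V n) :
    IsRestricted ρ := by
  set t := tPlus (opT ρ)
  have hcoeff : ∀ (f : (Module.End ℂ⟦X⟧ V)⟦X⟧) (k : ℕ), inUInv f (-(k : ℤ)) = coeff k f :=
    fun f k => by simp [inUInv]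
  have hunit : IsUnit (t 0 0) := by
    have h1 : constantCoeff (t 0 0) = ((1 : (Module.End ℂ⟦X⟧ V)ˣ) : Module.End ℂ⟦X⟧ V) := by
      rw [← coeff_zero_eq_constantCoeff_apply]; simp [t, tPlus]
    exact ⟨⟨t 0 0, invOfUnit (t 0 0) 1, mul_invOfUnit _ _ h1, invOfUnit_mul _ _ h1⟩, rfl⟩
  have h00 : Truncates (t 0 0) := fun v n => by
    simpa only [← h.k1_plus, hcoeff] using hkp 0 v n
  have hA : Truncates (Ring.inverse (t 0 0) * t 0 1) := truncates_of_hasHSum hxp h.x_plus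
  have hB : Truncates (t 1 0 * Ring.inverse (t 0 0)) := truncates_of_hasHSum hxm h.x_minus
  have hK : Truncates (t 1 1 - t 1 0 * Ring.inverse (t 0 0) * t 0 1) := fun v n => by
    simpa only [← h.k2_plus, hcoeff] using hkp 1 v n
  have h01 : Truncates (t 0 1) := by
    have := h00.mul hA
    rwa [← mul_assoc, Ring.mul_inverse_cancel _ hunit, one_mul] at this
  have h10 : Truncates (t 1 0) := by
    have := hB.mul h00
    rwa [mul_assoc, Ring.inverse_mul_cancel _ hunit, mul_one] at this
  have h11 : Truncates (t 1 1) := by simpa using hK.add (hB.mul h01)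
  have hall : ∀ i j, Truncates (t i j) := by
    intro i j
    fin_cases i <;> fin_cases j <;> assumption
  refine ⟨hV, fun v n _ i j => ?_⟩
  obtain ⟨N, hN⟩ := hall i j v n
  exact ⟨N, fun k hk => mem_hPow.1 (hN k hk)⟩

end Truncation

/-! ### The Fock space is topologically free -/

lemma algebraMap_fock_X : algebraMap ℂ⟦X⟧ Fock X = X := map_X _

lemma mem_hPow_of_coeff {n : ℕ} {v : Fock} (h : ∀ N < n, coeff N v = 0) : v ∈ hPow Fock n := by
  obtain ⟨w, rfl⟩ := X_pow_dvd_iff.2 h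
  exact mem_hPow.2 ⟨w, by rw [Algebra.smul_def, map_pow, algebraMap_fock_X]⟩

lemma isTopologicallyFree_fock : IsTopologicallyFree Fock := by
  have hinj : Function.Injective (algebraMap ℂ⟦X⟧ Fock) :=
    PowerSeries.map_injective _ (algebraMap ℂ Fock₀).injective
  constructor
  · refine Module.isTorsionFree_iff_smul_eq_zero.2 fun r v h => ?_
    rw [Algebra.smul_def, mul_eq_zero] at h
    exact h.imp_left fun h => hinj (by rw [h, map_zero])
  · rw [← IsAdicComplete.map_algebraMap_iff (S := Fock)]
    have : (Ideal.span {(X : ℂ⟦X⟧)}).map (algebraMap ℂ⟦X⟧ Fock) = Ideal.span {(X : Fock)} := by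
      rw [Ideal.map_span, Set.image_singleton, algebraMap_fock_X]
    rw [this]
    infer_instance

/-! ### Annihilation operators lower the degree -/

/-- The degree of a monomial in the `a_j(-r)`, where `a_j(-r)` has degree `r`. -/
def monDeg : (Fin 2 × ℕ+ →₀ ℕ) →+ ℕ := Finsupp.weight fun x => (x.2 : ℕ)

/-- The elements of `Fock₀` of degree at most `D` in the `a_j(-r)`; the factors `e^μ` have
degree `0`.  As `D` is an integer, this is the zero space for `D < 0`. -/
def degLE (D : ℤ) : Submodule ℂ Fock₀ where
  carrier := {v | ∀ m d, D < monDeg d → MvPolynomial.coeff d (v.coeff m) = 0}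
  add_mem' hv hw m d h := by simp [hv m d h, hw m d h]
  zero_mem' m d _ := by simp
  smul_mem' c v hv m d h := by simp [hv m d h]

lemma degLE_mono {D E : ℤ} (h : D ≤ E) : degLE D ≤ degLE E :=
  fun _ hv m d hd => hv m d (h.trans_lt hd)

lemma eq_zero_of_mem_degLE {D : ℤ} (hD : D < 0) {v : Fock₀} (hv : v ∈ degLE D) : v = 0 := by
  ext m d
  simpa using hv m d (by omega)

lemma exists_mem_degLE (v : Fock₀) : ∃ D : ℕ, v ∈ degLE D := by
  refine ⟨v.coeff.support.sup fun m => (v.coeff m).support.sup monDeg, fun m d hd => ?_⟩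
  by_contra hne
  have hm : m ∈ v.coeff.support := by
    rw [Finsupp.mem_support_iff]
    rintro h
    simp [h] at hne
  have h1 := Finset.le_sup (f := monDeg) (MvPolynomial.mem_support_iff.2 hne)
  have h2 := Finset.le_sup (f := fun m => (v.coeff m).support.sup monDeg) hm
  omega

lemma annihilate_mem_degLE (j : Fin 2) (r : ℕ+) {D : ℤ} {v : Fock₀} (hv : v ∈ degLE D) :
    annihilate j r v ∈ degLE (D - (r : ℕ)) := by
  intro m d hd
  have h : MvPolynomial.coeff (d + Finsupp.single (j, r) 1) (v.coeff m) = 0 := by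
    refine hv m _ ?_
    rw [map_add, monDeg, Finsupp.weight_single]
    simpa [monDeg, sub_lt_iff_lt_add] using hd
  simp [annihilate, MvPolynomial.coeff_pderiv, h]

/-- The coefficient of `u^{-k} h^l` lowers the degree by `k - l`. -/
def LowersDegree (G : OpSeries) : Prop :=
  ∀ (k l : ℕ) (D : ℤ) (v : Fock₀), v ∈ degLE D → coeff l (coeff k G) v ∈ degLE (D - k + l)

lemma lowersDegree_annihilateSum (j : Fin 2) (c : ℂ) : LowersDegree (annihilateSum j c) := by
  intro k l D v hv
  simp only [annihilateSum, coeff_mk]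
  split_ifs with hr
  · rw [LinearMap.smul_apply]
    refine Submodule.smul_mem _ _ (degLE_mono ?_ (annihilate_mem_degLE j _ hv))
    simp only [PNat.mk_coe]
    omega
  · simp

lemma LowersDegree.add {G H : OpSeries} (hG : LowersDegree G) (hH : LowersDegree H) :
    LowersDegree (G + H) := fun k l D v hv => by
  simpa using add_mem (hG k l D v hv) (hH k l D v hv)

lemma LowersDegree.neg {G : OpSeries} (hG : LowersDegree G) : LowersDegree (-G) :=
  fun k l D v hv => by simpa using hG k l D v hv

lemma LowersDegree.sub {G H : OpSeries} (hG : LowersDegree G) (hH : LowersDegree H) :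
    LowersDegree (G - H) := sub_eq_add_neg G H ▸ hG.add hH.neg

lemma lowersDegree_one : LowersDegree 1 := by
  intro k l D v hv
  rw [coeff_one]
  split_ifs with hk
  · rw [coeff_one]
    split_ifs with hl
    · simpa [hk, hl] using hv
    · simp
  · simp

lemma LowersDegree.mul {G H : OpSeries} (hG : LowersDegree G) (hH : LowersDegree H) :
    LowersDegree (G * H) := by
  intro k l D v hv
  rw [coeff_mul, map_sum, LinearMap.sum_apply]
  refine sum_mem fun p hp => ?_
  rw [coeff_mul, LinearMap.sum_apply]
  refine sum_mem fun q hq => ?_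
  rw [Finset.HasAntidiagonal.mem_antidiagonal] at hp hq
  rw [Module.End.mul_apply]
  exact degLE_mono (by omega) (hG p.1 q.1 _ _ (hH p.2 q.2 D v hv))

lemma LowersDegree.pow {G : OpSeries} (hG : LowersDegree G) (n : ℕ) : LowersDegree (G ^ n) := by
  induction n with
  | zero => simpa using lowersDegree_one
  | succ n ih => exact pow_succ G n ▸ ih.mul hG

lemma LowersDegree.fexp {G : OpSeries} (hG : LowersDegree G) : LowersDegree (fexp G) := by
  intro k l D v hv
  simp only [DYgl2.fexp, coeff_mk, LinearMap.sum_apply, LinearMap.smul_apply]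
  exact sum_mem fun n _ => Submodule.smul_mem _ _ (hG.pow n k l D v hv)

/-! ### Lower bounds for the powers of `u` in vertex operators -/

/-- For every vector and every power of `h`, the powers of `u` that occur are bounded below. -/
def BddBelowPowers (A : Vertex) : Prop := ∀ v l, ∃ N : ℤ, ∀ k < N, A v k l = 0

/-- For every vector and every power of `h`, only finitely many powers of `u` occur. -/
def FinitePowers (A : Vertex) : Prop := ∀ v l, ∃ N : ℤ, ∀ k, N < |k| → A v k l = 0

/-- Only nonnegative powers of `u` occur, and the zero vector is mapped to zero. -/
structure NonnegPowers (A : Vertex) : Prop where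
  map_zero : ∀ k l, A 0 k l = 0
  eq_zero : ∀ v k l, k < 0 → A v k l = 0

/-- If the powers of `u` in `B(u) v` are bounded below and those in `A(u)` are nonnegative, then the
powers in `A(u) B(u) v` are bounded below. -/
lemma NonnegPowers.comp {A B : Vertex} (hA : NonnegPowers A) (hB : BddBelowPowers B) :
    BddBelowPowers (comp A B) := by
  intro v l
  choose N hN using hB v
  refine ⟨(Finset.range (l + 1)).inf' ⟨0, by simp⟩ N, fun k hk => ?_⟩
  refine finsum_eq_zero_of_forall_eq_zero fun k' => Finset.sum_eq_zero fun p hp => ?_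
  rw [Finset.HasAntidiagonal.mem_antidiagonal] at hp
  have hk : k < N p.2 := hk.trans_le (Finset.inf'_le _ (Finset.mem_range.2 (by omega)))
  rcases lt_or_ge k k' with h | h
  · exact hA.eq_zero _ _ _ (by omega)
  · rw [hN p.2 k' (by omega), hA.map_zero]

lemma BddBelowPowers.comp {A B : Vertex} (hA : BddBelowPowers A) (hA0 : ∀ k l, A 0 k l = 0)
    (hB : FinitePowers B) : BddBelowPowers (comp A B) := by
  intro v l
  choose M hM using hB v
  choose N hN using hA
  obtain ⟨b, hb⟩ := (Finset.range (l + 1)).image M |>.bddAbove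
  let S : Finset (ℤ × ℕ × ℕ) :=
    Finset.Icc (-b) b ×ˢ Finset.range (l + 1) ×ˢ Finset.range (l + 1)
  obtain ⟨n, hn⟩ := (S.image fun x => N (B v x.1 x.2.2) x.2.1 + x.1) |>.bddBelow
  refine ⟨n, fun k hk => ?_⟩
  refine finsum_eq_zero_of_forall_eq_zero fun k' => Finset.sum_eq_zero fun p hp => ?_
  rw [Finset.HasAntidiagonal.mem_antidiagonal] at hp
  have hMb : M p.2 ≤ b := hb (by simpa using ⟨p.2, by omega, rfl⟩)
  rcases lt_or_ge b |k'| with h | h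
  · rw [hM p.2 k' (by omega), hA0]
  · refine hN _ _ _ ?_
    have : n ≤ N (B v k' p.2) p.1 + k' := hn (by
      simp only [Finset.coe_image, Set.mem_image, Finset.mem_coe]
      exact ⟨(k', p), by simp [S, abs_le.1 h]; omega, rfl⟩)
    omega

lemma FinitePowers.comp {A B : Vertex} (hA : FinitePowers A) (hA0 : ∀ k l, A 0 k l = 0)
    (hB : FinitePowers B) : FinitePowers (comp A B) := by
  intro v l
  choose M hM using hB v
  choose N hN using hA
  obtain ⟨b, hb⟩ := (Finset.range (l + 1)).image M |>.bddAbove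
  let S : Finset (ℤ × ℕ × ℕ) :=
    Finset.Icc (-b) b ×ˢ Finset.range (l + 1) ×ˢ Finset.range (l + 1)
  obtain ⟨n, hn⟩ := (S.image fun x => N (B v x.1 x.2.2) x.2.1 + |x.1|) |>.bddAbove
  refine ⟨n, fun k hk => ?_⟩
  refine finsum_eq_zero_of_forall_eq_zero fun k' => Finset.sum_eq_zero fun p hp => ?_
  rw [Finset.HasAntidiagonal.mem_antidiagonal] at hp
  have hMb : M p.2 ≤ b := hb (by simpa using ⟨p.2, by omega, rfl⟩)
  rcases lt_or_ge b |k'| with h | h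
  · rw [hM p.2 k' (by omega), hA0]
  · refine hN _ _ _ ?_
    have : N (B v k' p.2) p.1 + |k'| ≤ n := hn (by
      simp only [Finset.coe_image, Set.mem_image, Finset.mem_coe]
      exact ⟨(k', p), by simp [S, abs_le.1 h]; omega, rfl⟩)
    have := abs_sub_abs_le_abs_sub k k'
    omega

lemma nonnegPowers_vertexU (E : OpSeries) : NonnegPowers (vertexU E) where
  map_zero k l := by simp [vertexU]
  eq_zero v k l hk := by simp [vertexU, not_le.2 hk]

lemma nonnegPowers_vertexAtZero (E : OpSeries) : NonnegPowers (vertexAtZero E) where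
  map_zero k l := by simp [vertexAtZero]
  eq_zero v k l hk := by simp [vertexAtZero, hk.ne]

lemma vertexUInv_zero (E : OpSeries) (k : ℤ) (l : ℕ) : vertexUInv E 0 k l = 0 := by
  simp [vertexUInv]

/-- A series in `u⁻¹` whose coefficients lower the degree acts by finitely many powers of `u` in
each power of `h`, as there is nothing of negative degree. -/
lemma LowersDegree.bddBelowPowers {E : OpSeries} (hE : LowersDegree E) :
    BddBelowPowers (vertexUInv E) := by
  intro v l
  obtain ⟨D, hD⟩ := exists_mem_degLE v
  refine ⟨-(D + l : ℤ), fun k hk => ?_⟩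
  rw [vertexUInv, if_pos (by omega)]
  exact eq_zero_of_mem_degLE (by omega) (hE _ l D v hD)

lemma zeroMode_zero (d : ℤ) (p : ℤ → ℤ) (g : ℤ → ℂ⟦X⟧) (k : ℤ) (l : ℕ) :
    zeroMode d p g 0 k l = 0 := by
  simp [zeroMode]

lemma finitePowers_zeroMode (d : ℤ) (p : ℤ → ℤ) (g : ℤ → ℂ⟦X⟧) :
    FinitePowers (zeroMode d p g) := by
  intro v l
  obtain ⟨b, hb⟩ := (v.coeff.support.image fun m => |p m - l|) |>.bddAbove
  refine ⟨b, fun k hk => Finset.sum_eq_zero fun m hm => if_neg ?_⟩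
  rintro rfl
  exact absurd (hb (Finset.mem_coe.2 (Finset.mem_image_of_mem _ hm))) (not_le.2 hk)

lemma lowersDegree_exponentPlus (c : ℂ) : LowersDegree (exponentPlus c) :=
  (lowersDegree_annihilateSum _ _).sub (lowersDegree_annihilateSum _ _)

lemma bddBelowPowers_EPlus_comp (c : ℂ) {B : Vertex} (hB : FinitePowers B) :
    BddBelowPowers (comp (EPlus c) B) :=
  (lowersDegree_exponentPlus c).fexp.bddBelowPowers.comp (vertexUInv_zero _) hB

lemma bddBelowPowers_EPlusInv_comp (c : ℂ) {B : Vertex} (hB : FinitePowers B) :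
    BddBelowPowers (comp (EPlusInv c) B) :=
  (lowersDegree_exponentPlus c).neg.fexp.bddBelowPowers.comp (vertexUInv_zero _) hB

lemma bddBelowPowers_kPlusExp_comp (j : Fin 2) {B : Vertex} (hB : FinitePowers B) :
    BddBelowPowers (comp (kPlusExp j) B) :=
  ((lowersDegree_annihilateSum _ _).sub
    (lowersDegree_annihilateSum _ _)).neg.fexp.bddBelowPowers.comp (vertexUInv_zero _) hB

lemma bddBelowPowers_xPlusIK (i : Fin 2) : BddBelowPowers (xPlusIK i) :=
  (nonnegPowers_vertexU _).comp (bddBelowPowers_EPlus_comp _ (finitePowers_zeroMode _ _ _))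

lemma bddBelowPowers_xMinusIK (i : Fin 2) : BddBelowPowers (xMinusIK i) :=
  (nonnegPowers_vertexU _).comp (bddBelowPowers_EPlusInv_comp _ (finitePowers_zeroMode _ _ _))

lemma bddBelowPowers_kPlusIK (i : Fin 2) (s : ℂ) (j : Fin 2) : BddBelowPowers (kPlusIK i s j) :=
  bddBelowPowers_kPlusExp_comp j (finitePowers_zeroMode _ _ _)

lemma bddBelowPowers_xPlusNorm (i : Fin 2) : BddBelowPowers (xPlusNorm i) :=
  (nonnegPowers_vertexAtZero _).comp <| (nonnegPowers_vertexU _).comp <|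
    bddBelowPowers_EPlus_comp _ <|
      (finitePowers_zeroMode _ _ _).comp (zeroMode_zero _ _ _) (finitePowers_zeroMode _ _ _)

lemma bddBelowPowers_xMinusNorm (i : Fin 2) : BddBelowPowers (xMinusNorm i) :=
  (nonnegPowers_vertexAtZero _).comp <| (nonnegPowers_vertexU _).comp <|
    bddBelowPowers_EPlusInv_comp _ <|
      (finitePowers_zeroMode _ _ _).comp (zeroMode_zero _ _ _) (finitePowers_zeroMode _ _ _)

lemma bddBelowPowers_kPlusNorm (i j : Fin 2) : BddBelowPowers (kPlusNorm i j) :=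
  bddBelowPowers_kPlusExp_comp j (finitePowers_zeroMode _ _ _)

/-- Only finitely many coefficients of `v` and of `A(u)` matter modulo `h^n`. -/
lemma BddBelowPowers.extend_mem_hPow {A : Vertex} (hA : BddBelowPowers A) (v : Fock) (n : ℕ) :
    ∃ N : ℕ, ∀ k ≥ N, extend A (-(k : ℤ)) v ∈ hPow Fock n := by
  choose N hN using hA
  obtain ⟨b, hb⟩ := ((Finset.range n ×ˢ Finset.range n).image
    fun p => N (coeff p.2 v) p.1) |>.bddBelow
  refine ⟨b.natAbs + 1, fun k hk => mem_hPow_of_coeff fun M hM => ?_⟩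
  rw [extend, coeff_mk]
  refine Finset.sum_eq_zero fun p hp => hN _ _ _ ?_
  rw [Finset.HasAntidiagonal.mem_antidiagonal] at hp
  have : b ≤ N (coeff p.2 v) p.1 := hb (by
    simp only [Finset.coe_image, Set.mem_image, Finset.mem_coe]
    exact ⟨p, by simp; omega, rfl⟩)
  omega

end DYgl2

end
theorem mainTheorem10 (i : Fin 2) :
    (∀ (s : ℂ) (ρ : DYgl2.DY →ₐ[PowerSeries ℂ] Module.End (PowerSeries ℂ) DYgl2.Fock),
      DYgl2.IsIoharaKohno i s ρ → DYgl2.IsRestricted ρ) ∧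
    (∀ ρ : DYgl2.DY →ₐ[PowerSeries ℂ] Module.End (PowerSeries ℂ) DYgl2.Fock,
      DYgl2.IsNormalizedIoharaKohno i ρ → DYgl2.IsRestricted ρ) := by
  refine ⟨fun s ρ h => ?_, fun ρ h => ?_⟩
  · exact DYgl2.isRestricted_of_drinfeldActsBy DYgl2.isTopologicallyFree_fock h.2
      (DYgl2.bddBelowPowers_xPlusIK i).extend_mem_hPow
      (DYgl2.bddBelowPowers_xMinusIK i).extend_mem_hPow
      fun j => (DYgl2.bddBelowPowers_kPlusIK i s j).extend_mem_hPow
  · exact DYgl2.isRestricted_of_drinfeldActsBy DYgl2.isTopologicallyFree_fock h.2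
      (DYgl2.bddBelowPowers_xPlusNorm i).extend_mem_hPow
      (DYgl2.bddBelowPowers_xMinusNorm i).extend_mem_hPow
      fun j => (DYgl2.bddBelowPowers_kPlusNorm i j).extend_mem_hPow
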